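/- Let $(X,d_X)$ be a compact metric space without isolated points and $f\colon X\to X$ a continuous map such that: (i) $(X,f)$ is non-wandering: for every $x\in X$ and every neighbourhood $V$ of $x$ there is an integer $k\ge 1$ with $f^k(V)\cap V\neq\emptyset$; (ii) $f$ has the shadowing property: for every $\varepsilon>0$ there is $\delta>0$ such that for every sequence $(x_n)_{n\ge 0}$ in $X$ with $d_X(f(x_n),x_{n+1})<\delta$ for all $n\ge 0$ there is $x\in X$ with $d_X(f^n(x),x_n)<\varepsilon$ for all $n\ge 0$; (iii) $f$ is positively expansive: there is $\beta>0$ such that for all $x\ne y$ in $X$ there is an integer $n\ge 0$ with $d_X(f^n(x),f^n(y))>\beta$. Then for every integer $d\ge 1$ and every non-empty open set $U\subset X$ there are an integer $m\ge 1$, a closed set $Y\subset U$ with $f^m(Y)\subset Y$, and a homeomorphism $\pi\colon Y\to\{0,1,\dots,d\}^{\mathbb{N}_0}$ (with the product of the discrete topologies on $\{0,1,\dots,d\}$, where $\mathbb N_0=\{0,1,2,\dots\}$) such that $\pi\circ f^m|_Y=\sigma\circ\pi$, where $\sigma$ is the shift $\sigma(\alpha)_n=\alpha_{n+1}$. That is,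 $(Y,f^m)$ is conjugate to the full shift on $d+1$ symbols. -/

import Mathlib

open Set Function Topology

namespace TopDyn

/-- `x` is a non-wandering point of `f`: for every neighbourhood `U` of `x` there is a positive
integer `k` such that `f ^ k (U)` meets `U`. -/
def IsNonWanderingPt {X : Type*} [TopologicalSpace X] (f : X → X) (x : X) : Prop :=
  ∀ U ∈ 𝓝 x, ∃ k : ℕ, 0 < k ∧ (f^[k] '' U ∩ U).Nonempty

/-- The system `(X, f)` is non-wandering: every point is non-wandering. -/
def IsNonWandering {X : Type*} [TopologicalSpace X] (f : X → X) : Prop :=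
  ∀ x : X, IsNonWanderingPt f x

/-- `ξ` is a `δ`-pseudo orbit of `f`. -/
def IsPseudoOrbit {X : Type*} [MetricSpace X] (f : X → X) (δ : ℝ) (ξ : ℕ → X) : Prop :=
  ∀ n : ℕ, dist (f (ξ n)) (ξ (n + 1)) < δ

/-- The point `x` is `ε`-tracing the sequence `ξ`. -/
def IsTracing {X : Type*} [MetricSpace X] (f : X → X) (ε : ℝ) (ξ : ℕ → X) (x : X) : Prop :=
  ∀ n : ℕ, dist (f^[n] x) (ξ n) < ε

/-- The shadowing (pseudo-orbit tracing) property. -/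
def HasShadowing {X : Type*} [MetricSpace X] (f : X → X) : Prop :=
  ∀ ε : ℝ, 0 < ε → ∃ δ : ℝ, 0 < δ ∧
    ∀ ξ : ℕ → X, IsPseudoOrbit f δ ξ → ∃ x : X, IsTracing f ε ξ x

/-- Positive expansiveness: the forward orbits (time `0` included) of distinct points separate
by more than a uniform constant. -/
def IsPositivelyExpansive {X : Type*} [MetricSpace X] (f : X → X) : Prop :=
  ∃ β : ℝ, 0 < β ∧ ∀ x y : X, x ≠ y → ∃ n : ℕ, β < dist (f^[n] x) (f^[n] y)

/-- The one-sided shift map on sequences of symbols. The topology on `ℕ → Fin (d + 1)` is the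
product of the discrete topologies. -/
def shift {A : Type*} (α : ℕ → A) : ℕ → A := fun n => α (n + 1)

end TopDyn

namespace TopDyn

/-! Periodic points are dense and no point is isolated, so arbitrarily close together in `U` lie `d
+ 1` distinct periodic points with a common period `L`. Switching among their orbits every `L` steps
gives a pseudo-orbit for each symbol sequence. Shadowing traces it, and expansiveness makes the
tracing point unique; uniqueness yields equivariance and continuity of the coding, which
`exists_coding` collects. -/

/-- The sequence that follows, in the `k`-th block of length `L`, the orbit of `p (α k)`. -/
def blockOrbit {X A : Type*} (f : X → X) (L : ℕ) (p : A → X) (α : ℕ → A) (n : ℕ) : X :=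
  f^[n % L] (p (α (n / L)))

theorem blockOrbit_zero {X A : Type*} (f : X → X) (L : ℕ) (p : A → X) (α : ℕ → A) :
    blockOrbit f L p α 0 = p (α 0) := by
  simp [blockOrbit]

theorem blockOrbit_add {X A : Type*} (f : X → X) {L : ℕ} (hL : 0 < L) (p : A → X)
    (α : ℕ → A) (n : ℕ) : blockOrbit f L p α (n + L) = blockOrbit f L p (shift α) n := by
  simp [blockOrbit, shift, Nat.add_div_right _ hL]

theorem blockOrbit_mul_add {X A : Type*} (f : X → X) {L : ℕ} (p : A → X)
    (α : ℕ → A) (k : ℕ) {r : ℕ} (hr : r < L) :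
    blockOrbit f L p α (L * k + r) = f^[r] (p (α k)) := by
  rw [blockOrbit, Nat.mul_add_mod, Nat.mod_eq_of_lt hr, Nat.mul_add_div (by omega),
    Nat.div_eq_of_lt hr, add_zero]

theorem isPseudoOrbit_blockOrbit {X A : Type*} [MetricSpace X] {f : X → X} {L : ℕ} (hL : 0 < L)
    {p : A → X} {δ : ℝ} (hp : ∀ i j, dist (f^[L] (p i)) (p j) < δ) (α : ℕ → A) :
    IsPseudoOrbit f δ (blockOrbit f L p α) := by
  intro n
  obtain ⟨k, r, hr, rfl⟩ : ∃ k r, r < L ∧ n = L * k + r :=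
    ⟨n / L, n % L, Nat.mod_lt _ hL, (Nat.div_add_mod n L).symm⟩
  rw [blockOrbit_mul_add f p α k hr, ← iterate_succ_apply' f]
  rcases Nat.lt_or_ge (r + 1) L with h | h
  · rw [add_assoc, blockOrbit_mul_add f p α k h, dist_self]
    exact dist_nonneg.trans_lt (hp (α 0) (α 0))
  · obtain rfl : r + 1 = L := by omega
    have := blockOrbit_mul_add f p α (k + 1) hL
    rw [add_zero, mul_add, mul_one] at this
    rw [add_assoc, this]
    exact hp _ _

theorem continuous_blockOrbit {X A : Type*} [TopologicalSpace X] [TopologicalSpace A]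
    [DiscreteTopology A] (f : X → X) (L : ℕ) (p : A → X) (n : ℕ) :
    Continuous fun α : ℕ → A => blockOrbit f L p α n :=
  (continuous_of_discreteTopology (f := fun a => f^[n % L] (p a))).comp (continuous_apply (n / L))

/-- The bounds are non-strict so that tracing becomes a closed condition on the point. -/
theorem eq_of_dist_iterate_le {X : Type*} [MetricSpace X] {f : X → X} {β ε : ℝ}
    (hβ : ∀ x y : X, x ≠ y → ∃ n : ℕ, β < dist (f^[n] x) (f^[n] y)) (hε : 2 * ε ≤ β)
    {ξ : ℕ → X} {x y : X} (hx : ∀ n, dist (f^[n] x) (ξ n) ≤ ε)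
    (hy : ∀ n, dist (f^[n] y) (ξ n) ≤ ε) : x = y := by
  by_contra hne
  obtain ⟨n, hn⟩ := hβ x y hne
  linarith [dist_triangle_right (f^[n] x) (f^[n] y) (ξ n), hx n, hy n]

theorem IsTracing.iterate_blockOrbit {X A : Type*} [MetricSpace X] {f : X → X} {L : ℕ}
    (hL : 0 < L) {p : A → X} {α : ℕ → A} {ε : ℝ} {x : X}
    (hx : IsTracing f ε (blockOrbit f L p α) x) :
    IsTracing f ε (blockOrbit f L p (shift α)) (f^[L] x) := by
  intro n
  rw [← iterate_add_apply, ← blockOrbit_add f hL]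
  exact hx (n + L)

/-- Repeating a near-return segment gives a periodic pseudo-orbit; its tracing point `x` and `f^[k]
x` trace the same sequence, hence coincide. -/
theorem dense_periodicPts {X : Type*} [MetricSpace X] {f : X → X} (hnw : IsNonWandering f)
    (hsh : HasShadowing f) (hexp : IsPositivelyExpansive f) : Dense (periodicPts f) := by
  obtain ⟨β, hβ0, hβ⟩ := hexp
  rw [Metric.dense_iff]
  intro z r hr
  obtain ⟨δ, hδ, hsh⟩ := hsh (min (r / 2) (β / 2)) (by positivity)
  obtain ⟨k, hk, _, ⟨y, hy, rfl⟩, hky⟩ :=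
    hnw z _ (Metric.ball_mem_nhds z (show 0 < min (r / 2) (δ / 2) by positivity))
  rw [Metric.mem_ball, lt_min_iff] at hy hky
  obtain ⟨x, hx⟩ := hsh _ (isPseudoOrbit_blockOrbit (p := fun _ : Unit => y) hk
    (fun _ _ => by linarith [dist_triangle_right (f^[k] y) y z]) fun _ => ())
  refine ⟨x, ?_, k, hk, ?_⟩
  · have h := hx 0
    rw [blockOrbit_zero, iterate_zero_apply, lt_min_iff] at h
    rw [Metric.mem_ball]
    linarith [dist_triangle x y z]
  · refine eq_of_dist_iterate_le hβ (ε := min (r / 2) (β / 2)) (by linarith [min_le_right (r / 2) (β / 2)])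
      (fun n => (hx.iterate_blockOrbit hk n).le) (fun n => (hx n).le)

/-- In a `T1` space without isolated points, a dense set meets every non-empty open set in an
infinite set. -/
theorem infinite_inter_of_dense {X : Type*} [TopologicalSpace X] [T1Space X]
    (hiso : ∀ x : X, ¬ IsOpen ({x} : Set X)) {s V : Set X} (hs : Dense s) (hV : IsOpen V)
    (hne : V.Nonempty) : (V ∩ s).Infinite := by
  have : ∀ x : X, (𝓝[≠] x).NeBot := fun x =>
    ⟨fun h => hiso x ((isOpen_singleton_iff_punctured_nhds x).2 h)⟩
  intro hfin
  obtain ⟨x, hxV, hxs, hx⟩ := (hs.sdiff_finite hfin).inter_open_nonempty V hV hne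
  exact hx ⟨hxV, hxs⟩

theorem exists_common_period {X ι : Type*} [Fintype ι] {f : X → X} {p : ι → X}
    (hp : ∀ i, p i ∈ periodicPts f) : ∃ L, 0 < L ∧ ∀ i, IsPeriodicPt f L (p i) := by
  choose l hl hlp using hp
  exact ⟨∏ i, l i, Finset.prod_pos fun i _ => hl i,
    fun i => (hlp i).trans_dvd (Finset.dvd_prod_of_mem l (Finset.mem_univ i))⟩

/-- The map coding sequences of symbols by the points tracing the corresponding block orbits is a
topological embedding intertwining the shift and the iterate of `f`. -/
theorem exists_coding {X A : Type*} [MetricSpace X] [CompactSpace X] [Finite A]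
    [TopologicalSpace A] [DiscreteTopology A] {f : X → X} (hf : Continuous f) {β ε δ : ℝ}
    (hβ : ∀ x y : X, x ≠ y → ∃ n : ℕ, β < dist (f^[n] x) (f^[n] y)) (hε : 2 * ε ≤ β)
    (hsh : ∀ ξ : ℕ → X, IsPseudoOrbit f δ ξ → ∃ x : X, IsTracing f ε ξ x)
    {L : ℕ} (hL : 0 < L) {p : A → X} (hinj : Injective p) (hper : ∀ i, IsPeriodicPt f L (p i))
    (hp : ∀ i j, dist (p i) (p j) < δ) :
    ∃ T : (ℕ → A) → X, IsClosedEmbedding T ∧ (∀ α, dist (T α) (p (α 0)) < ε) ∧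
      Semiconj T shift f^[L] := by
  choose T hT using fun α : ℕ → A => hsh _ (isPseudoOrbit_blockOrbit hL
    (fun i j => by rw [(hper i).eq]; exact hp i j) α)
  have huniq : ∀ α x, (∀ n, dist (f^[n] x) (blockOrbit f L p α n) ≤ ε) → x = T α :=
    fun α x hx => eq_of_dist_iterate_le hβ hε hx fun n => (hT α n).le
  have hcont : Continuous T := by
    -- By uniqueness the graph is cut out by closed conditions; compactness of `X` then gives
    -- continuity.
    have hgraph : IsClosed {q : (ℕ → A) × X | q.2 = T q.1} := by
      have : {q : (ℕ → A) × X | q.2 = T q.1} =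
          ⋂ n, {q | dist (f^[n] q.2) (blockOrbit f L p q.1 n) ≤ ε} := by
        ext ⟨α, x⟩
        simp only [mem_ofPred_eq, mem_iInter]
        exact ⟨fun h n => h ▸ (hT α n).le, huniq α x⟩
      rw [this]
      exact isClosed_iInter fun n => isClosed_le
        (((hf.iterate n).comp continuous_snd).dist
          ((continuous_blockOrbit f L p n).comp continuous_fst)) continuous_const
    refine continuous_iff_isClosed.2 fun s hs => ?_
    convert isClosedMap_fst_of_compactSpace _ (hgraph.inter (hs.preimage continuous_snd)) using 1
    ext α
    simp
  have hTinj : Injective T := by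
    intro α γ h
    by_contra hne
    obtain ⟨k, hk⟩ := Function.ne_iff.1 hne
    -- Periodicity reduces the separation time modulo `L`, placing it inside block `k`, where a
    -- shared tracing point would force distance below `2 * ε ≤ β`.
    obtain ⟨n, hn⟩ := hβ _ _ (hinj.ne hk)
    rw [← (hper _).iterate_mod_apply n, ← (hper (γ k)).iterate_mod_apply n,
      ← blockOrbit_mul_add f p α k (Nat.mod_lt n hL),
      ← blockOrbit_mul_add f p γ k (Nat.mod_lt n hL)] at hn
    have h1 := hT α (L * k + n % L)
    have h2 := hT γ (L * k + n % L)
    rw [← h] at h2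
    linarith [dist_triangle_left (blockOrbit f L p α (L * k + n % L))
      (blockOrbit f L p γ (L * k + n % L)) (f^[L * k + n % L] (T α))]
  refine ⟨T, hcont.isClosedEmbedding hTinj, fun α => ?_, fun α => ?_⟩
  · simpa [blockOrbit_zero] using hT α 0
  · exact (huniq _ _ fun n => ((hT α).iterate_blockOrbit hL n).le).symm

end TopDyn

open TopDyn in
theorem mainTheorem7 {X : Type*} [MetricSpace X] [CompactSpace X] (f : X → X)
    (hf : Continuous f)
    (hnw : TopDyn.IsNonWandering f)
    (hsh : TopDyn.HasShadowing f)
    (hiso : ∀ x : X, ¬ IsOpen ({x} : Set X))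
    (hexp : TopDyn.IsPositivelyExpansive f)
    (d : ℕ) (hd : 1 ≤ d) (U : Set X) (hU : IsOpen U) (hUne : U.Nonempty) :
    ∃ m : ℕ, 0 < m ∧ ∃ Y : Set X, IsClosed Y ∧ Y ⊆ U ∧
      ∃ hY : Set.MapsTo (f^[m]) Y Y, ∃ π : Y ≃ₜ (ℕ → Fin (d + 1)),
        Function.Semiconj π (hY.restrict (f^[m]) Y Y) TopDyn.shift := by
  have hdense := dense_periodicPts hnw hsh hexp
  obtain ⟨β, hβ0, hβ⟩ := hexp
  obtain ⟨z, hz⟩ := hUne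
  obtain ⟨r, hr, hrU⟩ := Metric.isOpen_iff.1 hU z hz
  obtain ⟨δ, hδ, hsh⟩ := hsh (min (r / 2) (β / 2)) (by positivity)
  -- Radius `δ / 2` keeps the jumps below `δ`; `r / 2` leaves room for the tracing error inside `U`.
  have hinf := infinite_inter_of_dense hiso hdense
    (Metric.isOpen_ball (x := z) (ε := min (r / 2) (δ / 2))) ⟨z, Metric.mem_ball_self (by positivity)⟩
  let e := (Fin.valEmbedding (n := d + 1)).trans (hinf.natEmbedding)
  let p : Fin (d + 1) → X := fun i => e i
  have hpz : ∀ i, dist (p i) z < r / 2 ∧ dist (p i) z < δ / 2 :=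
    fun i => lt_min_iff.1 (e i).2.1
  obtain ⟨L, hL, hper⟩ := exists_common_period (p := p) fun i => (e i).2.2
  obtain ⟨T, hT, hTp, hsemi⟩ := exists_coding hf hβ (ε := min (r / 2) (β / 2))
    (by linarith [min_le_right (r / 2) (β / 2)]) hsh hL (p := p)
    (Subtype.val_injective.comp e.injective) hper
    (fun i j => by linarith [dist_triangle_right (p i) (p j) z, (hpz i).2, (hpz j).2])
  have hY : MapsTo f^[L] (range T) (range T) := by
    rintro _ ⟨α, rfl⟩
    exact ⟨shift α, hsemi α⟩
  refine ⟨L, hL, range T, hT.isClosed_range, ?_, hY, hT.isEmbedding.toHomeomorph.symm, ?_⟩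
  · rintro _ ⟨α, rfl⟩
    apply hrU
    rw [Metric.mem_ball]
    linarith [dist_triangle (T α) (p (α 0)) z, (lt_min_iff.1 (hTp α)).1, (hpz (α 0)).1]
  · have h : Semiconj hT.isEmbedding.toHomeomorph shift (hY.restrict f^[L] (range T) (range T)) :=
      fun α => Subtype.ext (hsemi α)
    exact h.inverse_left hT.isEmbedding.toHomeomorph.left_inv hT.isEmbedding.toHomeomorph.right_inv
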